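/- Corollary (high-SNR outage probability of joint secrecy and covert communications, JSACC). Setting. Alice reaches Bob only through a reconfigurable surface (RIS) with $N\ge 1$ elements of common amplitude $\beta\in(0,1]$. The complex channel coefficients $h_{AR,n}$ (Alice–RIS) and $h_{RB,n}$ (RIS–Bob), $1\le n\le N$, are mutually independent; $|h_{AR,n}|$ and $|h_{RB,n}|$ are Nakagami-$m$ with parameters $m_{AR}>0$ and $m_{RB}>0$ respectively and unit mean square, i.e. they have density $\frac{2m^m}{\Gamma(m)}x^{2m-1}e^{-mx^2}$ on $x\ge 0$. The phase shifts are $\theta_n=\tilde\theta-\arg(h_{RB,n}h_{AR,n})$ (mod $2\pi$) for a constant $\tilde\theta$, and $G=|\mathbf h_{RB}^T\Theta\,\mathbf h_{AR}|$ with $\Theta=\mathrm{diag}(\beta e^{j\theta_1},\dots,\beta e^{j\theta_N})$. The normalised Alice–RIS–Willie channel $g_{ARW}$ is circularly symmetric complex Gaussian, $g_{ARW}\sim\mathcal{CN}(0,N)$, and independent of all $h_{AR,n},h_{RB,n}$. With distances $d_\chi>0$ and path-loss exponents $\alpha_\chi$, put $\mathcal L_1=d_{RB}^{-\alpha_{RB}}d_{AR}^{-\alpha_{AR}}$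 and $\mathcal L_2=d_{RW}^{-\alpha_{RW}}d_{AR}^{-\alpha_{AR}}$. The noise powers $\sigma_B^2,\sigma_W^2>0$, the power fraction $\kappa\in(0,1]$, the bandwidth $B>0$ and the target rate $\bar R>0$ are fixed; the total power is $P_t=\rho\,\sigma_B^2$, where $\rho$ is the transmit SNR. Let $$R_s=\Big[B\log_2\Big(1+\tfrac{P_tG^2\mathcal L_1}{\sigma_B^2}\Big)-B\log_2\Big(1+\tfrac{P_t\beta^2|g_{ARW}|^2\mathcal L_2}{\sigma_W^2}\Big)\Big]^+,\qquad R_{CC}=B\log_2\Big(1+\tfrac{\kappa P_tG^2\mathcal L_1}{\sigma_B^2}\Big)$$ be the secrecy-mode and covert-mode rates (jamming is perfectly cancelled at Bob). The system uses secrecy mode, with rate $R_s$, if $R_s\ge\bar R$, and otherwise covert mode, with rate $R_{CC}$. The outage probability $\mathbb P_1(\rho)$ is the probability that the rate of the mode in use is less than $\bar R$. Claim. Suppose $m_{AR}\ne m_{RB}$, and let $m_s=\min\{m_{RB},m_{AR}\}$, $m_l=\max\{m_{RB},m_{AR}\}$, $$\tilde m=\frac{\sqrt\pi\,4^{m_s-m_l+1}(m_sm_l)^{m_s}\Gamma(2m_s)\Gamma(2m_l-2m_s)}{\Gamma(m_s)\Gamma(m_l)\Gamma(m_l-m_s+\frac12)},\qquad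 \tilde c_1=\sqrt{\frac{2^{\bar R/B}-1}{\beta^2\mathcal L_1}} .$$ Then, as $\rho\to\infty$, $\mathbb P_1(\rho)$ is asymptotically equivalent to $$\mathbb P_1^\infty(\rho)=\frac{\tilde m^N\,\tilde c_1^{\,2m_sN}\,\kappa^{-m_sN}}{\Gamma(2m_sN+1)}\,\rho^{-m_sN},$$ that is, $\mathbb P_1(\rho)/\mathbb P_1^\infty(\rho)\to 1$. -/

import Mathlib

open MeasureTheory ProbabilityTheory Filter Asymptotics
open scoped NNReal ENNReal Matrix

noncomputable section

namespace JSACC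

/-- Density of the Nakagami distribution with shape `m` and spread `Ω` (the mean square). -/
def nakagamiPDFReal (m Ω x : ℝ) : ℝ :=
  if 0 ≤ x then
    2 * m ^ m / (Real.Gamma m * Ω ^ m) * x ^ (2 * m - 1) * Real.exp (-(m / Ω) * x ^ 2)
  else 0

/-- The Nakagami distribution with shape `m` and spread `Ω`. -/
def nakagamiMeasure (m Ω : ℝ) : Measure ℝ :=
  volume.withDensity fun x => ENNReal.ofReal (nakagamiPDFReal m Ω x)

/-- The circularly symmetric complex Gaussian law `CN(0, v)`: real and imaginary parts are
independent centred Gaussians, each of variance `v / 2`. -/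
def circularGaussian (v : ℝ≥0) : Measure ℂ :=
  ((gaussianReal 0 (v / 2)).prod (gaussianReal 0 (v / 2))).map
    Complex.measurableEquivRealProd.symm

/-- The deterministic parameters of the system. -/
structure Params where
  /-- common reflection amplitude of the RIS elements -/
  β : ℝ
  /-- distances Alice-RIS, RIS-Bob and RIS-Willie -/
  dAR : ℝ
  dRB : ℝ
  dRW : ℝ
  /-- path-loss exponents of the same three links -/
  αAR : ℝ
  αRB : ℝ
  αRW : ℝ
  /-- noise standard deviations at Bob and at Willie -/
  σB : ℝ
  σW : ℝ
  /-- Alice's share of the total power in covert mode, `P_A = κ P_t` -/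
  κ : ℝ
  /-- bandwidth -/
  B : ℝ
  /-- target rate, which is also the threshold for switching between the two modes -/
  R : ℝ
  β_pos : 0 < β
  β_le_one : β ≤ 1
  dAR_pos : 0 < dAR
  dRB_pos : 0 < dRB
  dRW_pos : 0 < dRW
  σB_pos : 0 < σB
  σW_pos : 0 < σW
  κ_pos : 0 < κ
  κ_le_one : κ ≤ 1
  B_pos : 0 < B
  R_pos : 0 < R

/-- Path loss over distance `d` with exponent `α`. -/
def pathLoss (d α : ℝ) : ℝ := d ^ (-α)

/-- Path loss of the Alice-RIS-Bob link. -/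
def Params.L1 (p : Params) : ℝ := pathLoss p.dRB p.αRB * pathLoss p.dAR p.αAR

/-- Path loss of the Alice-RIS-Willie link. -/
def Params.L2 (p : Params) : ℝ := pathLoss p.dRW p.αRW * pathLoss p.dAR p.αAR

/-- The reflection matrix `diag(β e^{jθ₁}, …, β e^{jθ_N})`. -/
def reflectionMatrix {N : ℕ} (β : ℝ) (θ : Fin N → ℝ) : Matrix (Fin N) (Fin N) ℂ :=
  Matrix.diagonal fun n => (β : ℂ) * Complex.exp (Complex.I * (θ n : ℂ))

/-- The phase shifts (up to multiples of `2π`) that align all the reflected paths to Bob. -/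
def optimalPhase {N : ℕ} (θ₀ : ℝ) (hRB hAR : Fin N → ℂ) (n : Fin N) : ℝ :=
  θ₀ - Complex.arg (hRB n * hAR n)

/-- The cascaded gain `|h_RBᵀ Θ h_AR|` of the Alice-RIS-Bob link under the aligning phases. -/
def bobGain {N : ℕ} (β θ₀ : ℝ) (hRB hAR : Fin N → ℂ) : ℝ :=
  ‖hRB ⬝ᵥ (reflectionMatrix β (optimalPhase θ₀ hRB hAR) *ᵥ hAR)‖

/-- Bob's SINR in secrecy mode, for total power `Pt` and gain `G = |h_RBᵀ Θ h_AR|`. -/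
def sinrBobSC (p : Params) (Pt G : ℝ) : ℝ := Pt * G ^ 2 * p.L1 / p.σB ^ 2

/-- Willie's SINR in secrecy mode; `g` is the normalised channel `h_RWᵀ Θ h_AR / β`. -/
def sinrWillieSC (p : Params) (Pt : ℝ) (g : ℂ) : ℝ := Pt * (p.β * ‖g‖) ^ 2 * p.L2 / p.σW ^ 2

/-- Bob's SINR in covert mode: Alice sends with power `κ Pt`, and the jamming signal is
perfectly cancelled at Bob. -/
def sinrBobCC (p : Params) (Pt G : ℝ) : ℝ := (p.κ * Pt) * G ^ 2 * p.L1 / p.σB ^ 2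

/-- The rate `B log₂ (1 + SINR)`. -/
def rate (p : Params) (sinr : ℝ) : ℝ := p.B * Real.logb 2 (1 + sinr)

/-- The secrecy capacity `[R_B - R_W]⁺` of secrecy mode. -/
def secrecyRate (p : Params) (Pt G : ℝ) (g : ℂ) : ℝ :=
  max (rate p (sinrBobSC p Pt G) - rate p (sinrWillieSC p Pt g)) 0

open Classical in
/-- The rate of the joint scheme: secrecy mode while the secrecy capacity reaches the switch
threshold, covert mode otherwise. -/
def jsaccRate (p : Params) (Pt G : ℝ) (g : ℂ) : ℝ :=
  if p.R ≤ secrecyRate p Pt G g then secrecyRate p Pt G g else rate p (sinrBobCC p Pt G)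

/-- The outage probability of the joint scheme at transmit SNR `ρ`, that is, at total power
`P_t = ρ σ_B²`: the probability that the rate falls below the target. -/
def outageProb {Ω : Type*} [MeasurableSpace Ω] (μ : Measure Ω) {N : ℕ} (p : Params) (θ₀ : ℝ)
    (hAR hRB : Fin N → Ω → ℂ) (gARW : Ω → ℂ) (ρ : ℝ) : ℝ :=
  μ.real {ω | jsaccRate p (ρ * p.σB ^ 2)
    (bobGain p.β θ₀ (fun n => hRB n ω) (fun n => hAR n ω)) (gARW ω) < p.R}

/-- The constant `m̃`, for `s` the smaller and `l` the larger fading parameter. -/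
def mTilde (s l : ℝ) : ℝ :=
  Real.sqrt Real.pi * 4 ^ (s - l + 1) * (s * l) ^ s * Real.Gamma (2 * s)
      * Real.Gamma (2 * l - 2 * s)
    / (Real.Gamma s * Real.Gamma l * Real.Gamma (l - s + 1 / 2))

/-- The constant `c̃₁`. -/
def Params.c1 (p : Params) : ℝ := Real.sqrt ((2 ^ (p.R / p.B) - 1) / (p.β ^ 2 * p.L1))

/-- The high-SNR expression for the outage probability, `s` and `l` as above. -/
def outageInfty (p : Params) (N : ℕ) (s l ρ : ℝ) : ℝ :=
  mTilde s l ^ N * p.c1 ^ (2 * s * N) * p.κ ^ (-(s * N)) / Real.Gamma (2 * s * N + 1)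
    * ρ ^ (-(s * N))

end JSACC

end

namespace JSACC

open Set Topology

/-! The scheme is in outage exactly when both modes fail. Put S = Σ |h_AR,n| |h_RB,n|. The phases
align every reflected path, so G = βS, and covert mode fails iff S < x, where x = c̃₁/√(κρ). If
Willie's SINR is at least 1/κ, covert failure already forces secrecy failure. Willie's SINR misses
this level only when |g| ≤ r with r of order ρ^(-1/2), an event independent of S whose probability
tends to 0 because the Gaussian has no atom at 0. Hence the outage probability lies between (1 -
o(1)) P(S < x) and P(S < x) (`outageProb_bounds`).

What remains is the law of S near 0. The factor with smaller shape s has distribution function ~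
s^s/Γ(s+1) x^(2s). Multiplying by the independent factor of shape l > s scales this constant by the
moment E[Y^(-2s)], finite because s < l (`HasPowerCDF.mconv`). Duplication for Γ turns the constant
into m̃/Γ(2s+1). For sums, the Beta integral shows that exponents add and that constants written as
b/Γ(k+1) multiply in b (`HasPowerCDF.conv`, `hasPowerCDF_map_sum`). This gives P(S < x) ~ m̃^N
x^(2sN)/Γ(2sN+1). -/

/-! ### Power-law distribution functions at 0 under additive convolution. -/

/-- The measure on `(0, ∞)` whose distribution function is `x ↦ x ^ k`. -/
noncomputable def powerMeasure (k : ℝ) : Measure ℝ :=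
  (volume.restrict (Ioi 0)).withDensity fun x => ENNReal.ofReal (k * x ^ (k - 1))

instance (k : ℝ) : SFinite (powerMeasure k) := by
  unfold powerMeasure; infer_instance

lemma powerMeasure_Iio_of_nonpos (k : ℝ) {x : ℝ} (hx : x ≤ 0) : powerMeasure k (Iio x) = 0 := by
  rw [powerMeasure, withDensity_apply _ measurableSet_Iio,
    Measure.restrict_restrict measurableSet_Iio]
  have : Iio x ∩ Ioi 0 = ∅ := by
    ext y; simp only [mem_inter_iff, mem_Iio, mem_Ioi, mem_empty_iff_false, iff_false]
    intro h; linarith [h.1, h.2]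
  simp [this]

lemma powerMeasure_Iio {k x : ℝ} (hk : 0 < k) (hx : 0 < x) :
    powerMeasure k (Iio x) = ENNReal.ofReal (x ^ k) := by
  rw [powerMeasure, withDensity_apply _ measurableSet_Iio,
    Measure.restrict_restrict measurableSet_Iio, Iio_inter_Ioi]
  have hint : IntervalIntegrable (fun t : ℝ => k * t ^ (k - 1)) volume 0 x :=
    (intervalIntegral.intervalIntegrable_rpow' (by linarith)).const_mul k
  rw [← ofReal_integral_eq_lintegral_ofReal, ← integral_Ioc_eq_integral_Ioo,
    ← intervalIntegral.integral_of_le hx.le, intervalIntegral.integral_const_mul,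
    integral_rpow (Or.inl (by linarith))]
  · congr 1
    rw [sub_add_cancel, Real.zero_rpow hk.ne', sub_zero]
    field_simp
  · exact (intervalIntegrable_iff_integrableOn_Ioo_of_le hx.le).1 hint
  · filter_upwards [self_mem_ae_restrict measurableSet_Ioo] with t ht
    have := Real.rpow_nonneg ht.1.le (k - 1)
    positivity

lemma conv_Iio (μ ν : Measure ℝ) [SFinite ν] (x : ℝ) :
    (μ ∗ ν) (Iio x) = ∫⁻ z, ν (Iio (x - z)) ∂μ := by
  rw [← lintegral_indicator_one measurableSet_Iio,
    Measure.lintegral_conv (measurable_one.indicator measurableSet_Iio)]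
  refine lintegral_congr fun z => ?_
  rw [← lintegral_indicator_one measurableSet_Iio]
  refine lintegral_congr fun y => ?_
  simp only [indicator, mem_Iio, lt_sub_iff_add_lt', Pi.one_apply]

/-- As `μ` lives on `[0, ∞)`, the convolution below `x` sees `ν` only through arguments `x - z ≤ x`,
so a comparison near 0 is enough. -/
lemma conv_Iio_le {μ ν ν' : Measure ℝ} [SFinite ν] [SFinite ν'] (hμ : μ (Iio 0) = 0)
    {x : ℝ} {C : ℝ≥0∞} (h : ∀ y ≤ x, ν (Iio y) ≤ C * ν' (Iio y)) :
    (μ ∗ ν) (Iio x) ≤ C * (μ ∗ ν') (Iio x) := by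
  have hm : Measurable fun z => ν' (Iio (x - z)) :=
    Antitone.measurable fun a b hab => measure_mono (Iio_subset_Iio (by linarith))
  rw [conv_Iio, conv_Iio, ← lintegral_const_mul _ hm]
  refine lintegral_mono_ae ?_
  have : ∀ᵐ z ∂μ, 0 ≤ z := by
    rw [ae_iff]; simpa only [not_le, Iio_def] using hμ
  filter_upwards [this] with z hz
  exact h _ (by linarith)

lemma lintegral_rpow_mul_rpow {k p x : ℝ} (hk : 0 < k) (hp : 0 < p) (hx : 0 < x) :
    ∫⁻ z in Ioo 0 x, ENNReal.ofReal (k * z ^ (k - 1) * (x - z) ^ p) =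
      ENNReal.ofReal (Real.Gamma (k + 1) * Real.Gamma (p + 1) / Real.Gamma (k + p + 1)
        * x ^ (k + p)) := by
  have hint : IntervalIntegrable (fun z : ℝ => k * z ^ (k - 1) * (x - z) ^ p) volume 0 x := by
    refine IntervalIntegrable.mul_continuousOn
      ((intervalIntegral.intervalIntegrable_rpow' (by linarith)).const_mul k) ?_
    exact ContinuousOn.rpow_const (by fun_prop) fun z _ => Or.inr hp.le
  have hval : ∫ z in (0 : ℝ)..x, z ^ (k - 1) * (x - z) ^ p = x ^ (k + p) * beta k (p + 1) := by
    have h := Complex.betaIntegral_scaled (k : ℂ) ((p + 1 : ℝ) : ℂ) hx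
    have hl : ∫ z in (0 : ℝ)..x, (z : ℂ) ^ ((k : ℂ) - 1) * ((x : ℂ) - z) ^ (((p + 1 : ℝ) : ℂ) - 1)
        = ((∫ z in (0 : ℝ)..x, z ^ (k - 1) * (x - z) ^ p : ℝ) : ℂ) := by
      rw [← intervalIntegral.integral_ofReal]
      refine intervalIntegral.integral_congr fun z hz => ?_
      rw [uIcc_of_le hx.le] at hz
      rw [Complex.ofReal_mul, Complex.ofReal_cpow hz.1, Complex.ofReal_cpow (by linarith [hz.2])]
      push_cast
      ring_nf
    rw [hl] at h
    have h2 := congrArg Complex.re h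
    rw [Complex.ofReal_re] at h2
    rw [h2, beta_eq_betaIntegralReal _ _ hk (by linarith)]
    have : (x : ℂ) ^ ((k : ℂ) + ((p + 1 : ℝ) : ℂ) - 1) = ((x ^ (k + p) : ℝ) : ℂ) := by
      rw [Complex.ofReal_cpow hx.le]; push_cast; ring_nf
    rw [this, Complex.re_ofReal_mul]
  rw [← ofReal_integral_eq_lintegral_ofReal, ← integral_Ioc_eq_integral_Ioo,
    ← intervalIntegral.integral_of_le hx.le]
  · simp_rw [mul_assoc]
    rw [intervalIntegral.integral_const_mul, hval, beta, Real.Gamma_add_one hk.ne', ← add_assoc]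
    congr 1; ring
  · exact (intervalIntegrable_iff_integrableOn_Ioo_of_le hx.le).1 hint
  · filter_upwards [self_mem_ae_restrict measurableSet_Ioo] with t ht
    have := Real.rpow_nonneg ht.1.le (k - 1)
    have := Real.rpow_nonneg (sub_nonneg.2 ht.2.le) p
    positivity

lemma powerMeasure_conv_Iio {k p x : ℝ} (hk : 0 < k) (hp : 0 < p) (hx : 0 < x) :
    (powerMeasure k ∗ powerMeasure p) (Iio x) =
      ENNReal.ofReal (Real.Gamma (k + 1) * Real.Gamma (p + 1) / Real.Gamma (k + p + 1)
        * x ^ (k + p)) := by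
  have hm : Measurable fun z => powerMeasure p (Iio (x - z)) :=
    Antitone.measurable fun a b hab => measure_mono (Iio_subset_Iio (by linarith))
  rw [conv_Iio, ← lintegral_rpow_mul_rpow hk hp hx, powerMeasure,
    lintegral_withDensity_eq_lintegral_mul _ (by fun_prop) hm,
    ← lintegral_inter_add_sdiff _ (Ioi 0) measurableSet_Iio (B := Iio x)]
  -- For `z ≥ x` the inner mass below `x - z ≤ 0` vanishes.
  rw [setLIntegral_eq_zero (measurableSet_Ioi.diff measurableSet_Iio), add_zero, Ioi_inter_Iio]
  · refine setLIntegral_congr_fun measurableSet_Ioo fun z hz => ?_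
    simp only [Pi.mul_apply]
    rw [powerMeasure_Iio hp (by linarith [hz.2]), ← ENNReal.ofReal_mul]
    have := Real.rpow_nonneg hz.1.le (k - 1)
    positivity
  · intro z hz
    simp only [Set.mem_sdiff, mem_Ioi, mem_Iio, not_lt] at hz
    simp [powerMeasure_Iio_of_nonpos p (x := x - z) (by linarith [hz.2])]

/-- A measure on `[0, ∞)` whose distribution function is asymptotic to `a * x ^ k` at `0`. -/
structure HasPowerCDF (ν : Measure ℝ) (k a : ℝ) : Prop where
  neg : ν (Iio 0) = 0
  tendsto : Tendsto (fun x => ν.real (Iio x) / x ^ k) (𝓝[>] 0) (𝓝 a)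

/-- Recasts the limit as domination in both directions, uniform over all `y ≤ x`, which is the
hypothesis of `conv_Iio_le`. -/
lemma HasPowerCDF.exists_bounds {ν : Measure ℝ} [IsFiniteMeasure ν] {k a : ℝ}
    (h : HasPowerCDF ν k a) (hk : 0 < k) {b c : ℝ} (hb : b < a) (hb0 : 0 < b) (hc : a < c) :
    ∀ᶠ x in 𝓝[>] 0, ∀ y ≤ x, ν (Iio y) ≤ ENNReal.ofReal c * powerMeasure k (Iio y) ∧
      powerMeasure k (Iio y) ≤ ENNReal.ofReal b⁻¹ * ν (Iio y) := by
  have h1 := h.tendsto.eventually (Ioo_mem_nhds hb hc)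
  obtain ⟨δ, hδ, h2⟩ := mem_nhdsGT_iff_exists_Ioo_subset.1 h1
  filter_upwards [Ioo_mem_nhdsGT hδ] with x hx y hy
  rcases le_or_gt y 0 with hy0 | hy0
  · have : ν (Iio y) = 0 := measure_mono_null (Iio_subset_Iio hy0) h.neg
    simp [this, powerMeasure_Iio_of_nonpos k hy0]
  · have h3 : ν.real (Iio y) / y ^ k ∈ Ioo b c := h2 ⟨hy0, hy.trans_lt hx.2⟩
    have hyk : 0 < y ^ k := Real.rpow_pos_of_pos hy0 k
    have e : ν (Iio y) = ENNReal.ofReal (ν.real (Iio y)) := by simp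
    rw [powerMeasure_Iio hk hy0, e, ← ENNReal.ofReal_mul (by linarith),
      ← ENNReal.ofReal_mul (by positivity)]
    constructor <;> apply ENNReal.ofReal_le_ofReal
    · exact ((div_lt_iff₀ hyk).1 h3.2).le
    · rw [inv_mul_eq_div, le_div_iff₀ hb0, mul_comm]
      exact ((lt_div_iff₀ hyk).1 h3.1).le

lemma HasPowerCDF.conv {μ ν : Measure ℝ} [IsProbabilityMeasure μ] [IsProbabilityMeasure ν]
    {k a p b : ℝ} (hμ : HasPowerCDF μ k a) (hν : HasPowerCDF ν p b)
    (hk : 0 < k) (hp : 0 < p) (ha : 0 < a) (hb : 0 < b) :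
    HasPowerCDF (μ ∗ ν) (k + p)
      (a * b * (Real.Gamma (k + 1) * Real.Gamma (p + 1) / Real.Gamma (k + p + 1))) := by
  set K := Real.Gamma (k + 1) * Real.Gamma (p + 1) / Real.Gamma (k + p + 1) with hK
  have hKpos : 0 < K := by
    have := Real.Gamma_pos_of_pos (show 0 < k + 1 by linarith)
    have := Real.Gamma_pos_of_pos (show 0 < p + 1 by linarith)
    have := Real.Gamma_pos_of_pos (show 0 < k + p + 1 by linarith)
    positivity
  have hp0 : powerMeasure k (Iio 0) = 0 := powerMeasure_Iio_of_nonpos k le_rfl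
  constructor
  · rw [conv_Iio, lintegral_eq_zero_iff
      (Antitone.measurable fun a b hab => measure_mono (Iio_subset_Iio (by linarith)))]
    have : ∀ᵐ z ∂μ, 0 ≤ z := by
      rw [ae_iff]; simpa only [not_le, Iio_def] using hμ.neg
    filter_upwards [this] with z hz
    exact measure_mono_null (Iio_subset_Iio (by linarith)) hν.neg
  -- Both factors are traded for power measures, whose convolution is explicit, at the cost of
  -- constants arbitrarily close to `a` and `b`.
  · have key : ∀ a₁ b₁ a₂ b₂ : ℝ, 0 < a₁ → 0 < b₁ → a₁ < a → b₁ < b → a < a₂ → b < b₂ →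
        ∀ᶠ x in 𝓝[>] (0 : ℝ), a₁ * b₁ * K ≤ (μ ∗ ν).real (Iio x) / x ^ (k + p) ∧
          (μ ∗ ν).real (Iio x) / x ^ (k + p) ≤ a₂ * b₂ * K := by
      intro a₁ b₁ a₂ b₂ ha₁ hb₁ ha₁' hb₁' ha₂ hb₂
      have ha₂0 : 0 < a₂ := ha.trans ha₂
      have hb₂0 : 0 < b₂ := hb.trans hb₂
      filter_upwards [hμ.exists_bounds hk ha₁' ha₁ ha₂, hν.exists_bounds hp hb₁' hb₁ hb₂,
        self_mem_nhdsWithin] with x hx1 hx2 hx0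
      have hx0 : 0 < x := hx0
      have hxp : 0 < x ^ (k + p) := Real.rpow_pos_of_pos hx0 _
      have hPP := powerMeasure_conv_Iio hk hp hx0
      have e : (μ ∗ ν) (Iio x) = ENNReal.ofReal ((μ ∗ ν).real (Iio x)) := by simp
      have up : (μ ∗ ν) (Iio x) ≤
          ENNReal.ofReal b₂ * (ENNReal.ofReal a₂ * (powerMeasure k ∗ powerMeasure p) (Iio x)) := by
        refine (conv_Iio_le hμ.neg fun y hy => (hx2 y hy).1).trans ?_
        gcongr
        -- `conv_Iio_le` compares second factors only, so commutativity brings the other factor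
        -- there.
        rw [Measure.conv_comm μ, Measure.conv_comm (powerMeasure k)]
        exact conv_Iio_le (powerMeasure_Iio_of_nonpos p le_rfl) fun y hy => (hx1 y hy).1
      have lo : (powerMeasure k ∗ powerMeasure p) (Iio x) ≤
          ENNReal.ofReal b₁⁻¹ * (ENNReal.ofReal a₁⁻¹ * (μ ∗ ν) (Iio x)) := by
        refine (conv_Iio_le hp0 fun y hy => (hx2 y hy).2).trans ?_
        gcongr
        rw [Measure.conv_comm μ, Measure.conv_comm (powerMeasure k)]
        exact conv_Iio_le hν.neg fun y hy => (hx1 y hy).2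
      rw [hPP, e, ← ENNReal.ofReal_mul ha₂0.le, ← ENNReal.ofReal_mul hb₂0.le,
        ENNReal.ofReal_le_ofReal_iff (by positivity)] at up
      rw [hPP, e, ← ENNReal.ofReal_mul (by positivity), ← ENNReal.ofReal_mul (by positivity),
        ENNReal.ofReal_le_ofReal_iff (by positivity)] at lo
      rw [le_div_iff₀ hxp, div_le_iff₀ hxp]
      constructor
      · rw [← mul_assoc, ← mul_inv, inv_mul_eq_div, le_div_iff₀ (by positivity)] at lo
        linarith
      · linarith
    have lim : Tendsto (fun t : ℝ => (a * t) * (b * t) * K) (𝓝 1) (𝓝 (a * b * K)) := by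
      have : ContinuousAt (fun t : ℝ => (a * t) * (b * t) * K) 1 := by fun_prop
      simpa [ContinuousAt] using this
    rw [tendsto_order]
    constructor
    · intro l hl
      obtain ⟨t, ht, ht1, ht2⟩ : ∃ t, l < (a * t) * (b * t) * K ∧ 0 < t ∧ t < 1 :=
        (((lim.mono_left nhdsWithin_le_nhds).eventually (lt_mem_nhds hl)).and
          (Ioo_mem_nhdsLT (show (0 : ℝ) < 1 by norm_num))).exists
      -- Only the lower bound matters here; the upper constants `a * 2`, `b * 2` are arbitrary.
      filter_upwards [key (a * t) (b * t) (a * 2) (b * 2) (by positivity) (by positivity)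
        (by nlinarith) (by nlinarith) (by linarith) (by linarith)] with x hx
      exact ht.trans_le hx.1
    · intro l hl
      obtain ⟨t, ht, ht1, ht2⟩ : ∃ t, (a * t) * (b * t) * K < l ∧ 1 < t ∧ t < 2 :=
        (((lim.mono_left nhdsWithin_le_nhds).eventually (gt_mem_nhds hl)).and
          (Ioo_mem_nhdsGT (show (1 : ℝ) < 2 by norm_num))).exists
      filter_upwards [key (a / 2) (b / 2) (a * t) (b * t) (by positivity) (by positivity)
        (by linarith) (by linarith) (by nlinarith) (by nlinarith)] with x hx
      exact hx.2.trans_lt ht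

/-! ### Power-law distribution functions under products. -/

lemma mconv_real_Iio {μ ν : Measure ℝ} [IsFiniteMeasure μ] [IsFiniteMeasure ν]
    (hν : ν (Iic 0) = 0) (z : ℝ) :
    (ν ∗ₘ μ).real (Iio z) = ∫ y, μ.real (Iio (z / y)) ∂ν := by
  have hpos : ∀ᵐ y ∂ν, 0 < y := by
    rw [ae_iff]; simpa only [not_lt, Iic_def] using hν
  have h : (ν ∗ₘ μ) (Iio z) = ∫⁻ y, μ (Iio (z / y)) ∂ν := by
    rw [← lintegral_indicator_one measurableSet_Iio,
      Measure.lintegral_mconv (measurable_one.indicator measurableSet_Iio)]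
    refine lintegral_congr_ae ?_
    filter_upwards [hpos] with y hy
    rw [← lintegral_indicator_one measurableSet_Iio]
    refine lintegral_congr fun x => ?_
    simp only [indicator, mem_Iio, lt_div_iff₀' hy, Pi.one_apply]
  have hm : AEMeasurable (fun y => μ (Iio (z / y))) ν := by
    have : Measurable fun x => μ (Iio x) :=
      Monotone.measurable fun a b hab => measure_mono (Iio_subset_Iio hab)
    exact (this.comp (measurable_const.div measurable_id)).aemeasurable
  rw [measureReal_def, h]
  exact (integral_toReal hm (Eventually.of_forall fun y => measure_lt_top _ _)).symm

/-- Breiman-type asymptotics of the distribution function of a product at `0`. -/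
lemma HasPowerCDF.mconv {μ ν : Measure ℝ} [IsFiniteMeasure μ] [IsFiniteMeasure ν]
    {k a C : ℝ} (h : HasPowerCDF μ k a) (hν : ν (Iic 0) = 0)
    (hC : ∀ x > 0, μ.real (Iio x) ≤ C * x ^ k) (hint : Integrable (fun y : ℝ => y ^ (-k)) ν) :
    HasPowerCDF (ν ∗ₘ μ) k (a * ∫ y, y ^ (-k) ∂ν) := by
  have hpos : ∀ᵐ y ∂ν, 0 < y := by
    rw [ae_iff]; simpa only [not_lt, Iic_def] using hν
  have hF : Measurable fun x => μ.real (Iio x) :=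
    Monotone.measurable fun a b hab => measureReal_mono (Iio_subset_Iio hab)
  constructor
  · have h0 : (ν ∗ₘ μ).real (Iio 0) = 0 := by
      rw [mconv_real_Iio hν]
      simp [measureReal_def, h.neg]
    exact (measureReal_eq_zero_iff).1 h0
  · rw [← integral_const_mul]
    have e : ∀ z : ℝ, (ν ∗ₘ μ).real (Iio z) / z ^ k
        = ∫ y, μ.real (Iio (z / y)) / z ^ k ∂ν := fun z => by
      rw [mconv_real_Iio hν, integral_div]
    simp_rw [e]
    -- The global bound `hC` at `z / y`, divided by `z ^ k`, gives the dominating function `C * y ^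
    -- (-k)`, free of `z`.
    refine tendsto_integral_filter_of_dominated_convergence (fun y => C * y ^ (-k)) ?_ ?_
      (hint.const_mul C) ?_
    · refine Eventually.of_forall fun z => ?_
      exact ((hF.comp (measurable_const.div measurable_id)).div_const _).aestronglyMeasurable
    · filter_upwards [self_mem_nhdsWithin] with z hz
      have hz : 0 < z := hz
      filter_upwards [hpos] with y hy
      have hzk : 0 < z ^ k := Real.rpow_pos_of_pos hz k
      rw [Real.norm_of_nonneg (by positivity), div_le_iff₀ hzk]
      refine (hC _ (div_pos hz hy)).trans_eq ?_
      rw [Real.div_rpow hz.le hy.le, Real.rpow_neg hy.le]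
      ring
    · filter_upwards [hpos] with y hy
      have hlim : Tendsto (fun z : ℝ => z / y) (𝓝[>] 0) (𝓝[>] 0) := by
        refine tendsto_nhdsWithin_iff.2 ⟨?_, ?_⟩
        · have : Tendsto (fun z : ℝ => z / y) (𝓝 0) (𝓝 (0 / y)) := tendsto_id.div_const y
          rw [zero_div] at this
          exact this.mono_left nhdsWithin_le_nhds
        · filter_upwards [self_mem_nhdsWithin] with z hz
          exact div_pos hz hy
      refine ((h.tendsto.comp hlim).mul_const (y ^ (-k))).congr' ?_
      filter_upwards [self_mem_nhdsWithin] with z hz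
      have hz : 0 < z := hz
      have hyk : 0 < y ^ k := Real.rpow_pos_of_pos hy k
      have hzk : 0 < z ^ k := Real.rpow_pos_of_pos hz k
      simp only [Function.comp]
      rw [Real.div_rpow hz.le hy.le, Real.rpow_neg hy.le]
      field_simp

/-! ### The Nakagami law and the product of two of them. -/

lemma nakagamiPDFReal_of_pos {m x : ℝ} (hx : 0 < x) :
    nakagamiPDFReal m 1 x =
      2 * m ^ m / Real.Gamma m * (x ^ (2 * m - 1) * Real.exp (-m * x ^ 2)) := by
  simp [nakagamiPDFReal, hx.le, mul_assoc]

lemma nakagamiPDFReal_nonneg {m : ℝ} (hm : 0 < m) (x : ℝ) : 0 ≤ nakagamiPDFReal m 1 x := by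
  unfold nakagamiPDFReal
  have := Real.Gamma_pos_of_pos hm
  split_ifs with h
  · have := Real.rpow_nonneg h (2 * m - 1)
    positivity
  · exact le_rfl

lemma measurable_nakagamiPDFReal (m : ℝ) : Measurable (nakagamiPDFReal m 1) := by
  unfold nakagamiPDFReal
  exact Measurable.ite measurableSet_Ici (by fun_prop) measurable_const

lemma nakagamiMeasure_Iic_zero (m : ℝ) : nakagamiMeasure m 1 (Iic 0) = 0 := by
  rw [nakagamiMeasure, withDensity_apply _ measurableSet_Iic, ← setLIntegral_congr Iio_ae_eq_Iic]
  refine setLIntegral_eq_zero measurableSet_Iio fun x hx => ?_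
  have hx : x < 0 := hx
  simp [nakagamiPDFReal, hx.not_ge]

lemma nakagamiMeasure_Iio (m x : ℝ) : nakagamiMeasure m 1 (Iio x) =
    ∫⁻ t in Ioo 0 x, ENNReal.ofReal (nakagamiPDFReal m 1 t) := by
  rw [← withDensity_apply _ measurableSet_Ioo]
  change nakagamiMeasure m 1 (Iio x) = nakagamiMeasure m 1 (Ioo 0 x)
  refine le_antisymm ?_ (measure_mono fun t ht => ht.2)
  calc nakagamiMeasure m 1 (Iio x) ≤ nakagamiMeasure m 1 (Iic 0 ∪ Ioo 0 x) :=
        measure_mono fun t ht => by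
          rcases le_or_gt t 0 with h | h
          · exact Or.inl h
          · exact Or.inr ⟨h, ht⟩
    _ ≤ nakagamiMeasure m 1 (Iic 0) + nakagamiMeasure m 1 (Ioo 0 x) := measure_union_le _ _
    _ = nakagamiMeasure m 1 (Ioo 0 x) := by rw [nakagamiMeasure_Iic_zero, zero_add]

/-- On `(0, x)` the exponential in the density lies between `exp (-m * x ^ 2)` and 1. The upper
bound holds for every `x > 0`, so it also supplies the global bound needed by `HasPowerCDF.mconv`.
-/
lemma nakagamiMeasure_Iio_bounds {m x : ℝ} (hm : 0 < m) (hx : 0 < x) :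
    nakagamiMeasure m 1 (Iio x) ≤ ENNReal.ofReal (m ^ m / Real.Gamma (m + 1) * x ^ (2 * m)) ∧
    ENNReal.ofReal (m ^ m / Real.Gamma (m + 1) * Real.exp (-m * x ^ 2) * x ^ (2 * m)) ≤
      nakagamiMeasure m 1 (Iio x) := by
  have hΓ := Real.Gamma_pos_of_pos hm
  have hΓ' := Real.Gamma_pos_of_pos (show 0 < m + 1 by linarith)
  have hP : ENNReal.ofReal (x ^ (2 * m)) =
      ∫⁻ t in Ioo 0 x, ENNReal.ofReal (2 * m * t ^ (2 * m - 1)) := by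
    rw [← powerMeasure_Iio (by positivity) hx, powerMeasure, withDensity_apply _ measurableSet_Iio,
      Measure.restrict_restrict measurableSet_Iio, Iio_inter_Ioi]
  have hmm : Measurable fun t : ℝ => ENNReal.ofReal (2 * m * t ^ (2 * m - 1)) := by fun_prop
  have hc : 2 * m ^ m / Real.Gamma m = m ^ m / Real.Gamma (m + 1) * (2 * m) := by
    rw [Real.Gamma_add_one hm.ne']; field_simp
  rw [nakagamiMeasure_Iio, ENNReal.ofReal_mul (by positivity), ENNReal.ofReal_mul (by positivity),
    hP, ← lintegral_const_mul _ hmm, ← lintegral_const_mul _ hmm]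
  constructor <;> refine setLIntegral_mono' measurableSet_Ioo fun t ht => ?_ <;>
    rw [← ENNReal.ofReal_mul (by positivity), nakagamiPDFReal_of_pos ht.1, hc] <;>
    refine ENNReal.ofReal_le_ofReal ?_ <;>
    have htm := Real.rpow_pos_of_pos ht.1 (2 * m - 1)
  · have : Real.exp (-m * t ^ 2) ≤ 1 := Real.exp_le_one_iff.2 (by nlinarith [sq_nonneg t])
    rw [mul_assoc (m ^ m / _)]
    gcongr
    exact mul_le_of_le_one_right htm.le this
  · have : Real.exp (-m * x ^ 2) ≤ Real.exp (-m * t ^ 2) := by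
      refine Real.exp_le_exp.2 ?_
      have : t ^ 2 ≤ x ^ 2 := by have := ht.1; have := ht.2; gcongr
      nlinarith
    calc _ = m ^ m / Real.Gamma (m + 1) * (2 * m) *
          (t ^ (2 * m - 1) * Real.exp (-m * x ^ 2)) := by ring
      _ ≤ _ := by gcongr

lemma hasPowerCDF_nakagamiMeasure {m : ℝ} [IsFiniteMeasure (nakagamiMeasure m 1)] (hm : 0 < m) :
    HasPowerCDF (nakagamiMeasure m 1) (2 * m) (m ^ m / Real.Gamma (m + 1)) := by
  have hΓ' := Real.Gamma_pos_of_pos (show 0 < m + 1 by linarith)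
  refine ⟨measure_mono_null Iio_subset_Iic_self (nakagamiMeasure_Iic_zero m), ?_⟩
  have lim : Tendsto (fun x : ℝ => m ^ m / Real.Gamma (m + 1) * Real.exp (-m * x ^ 2)) (𝓝[>] 0)
      (𝓝 (m ^ m / Real.Gamma (m + 1))) := by
    have : ContinuousAt (fun x : ℝ => m ^ m / Real.Gamma (m + 1) * Real.exp (-m * x ^ 2)) 0 := by
      fun_prop
    have h := this.tendsto
    simp only [ne_eq, OfNat.ofNat_ne_zero, not_false_eq_true, zero_pow, mul_zero, Real.exp_zero,
      mul_one] at h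
    exact h.mono_left nhdsWithin_le_nhds
  refine tendsto_of_tendsto_of_tendsto_of_le_of_le' lim tendsto_const_nhds ?_ ?_ <;>
    filter_upwards [self_mem_nhdsWithin] with x hx <;>
    have hx : 0 < x := hx <;>
    have hb := nakagamiMeasure_Iio_bounds hm hx <;>
    have hxk : 0 < x ^ (2 * m) := Real.rpow_pos_of_pos hx _
  · rw [le_div_iff₀ hxk]
    exact (ENNReal.ofReal_le_iff_le_toReal (measure_ne_top _ _)).1 hb.2
  · rw [div_le_iff₀ hxk]
    exact ENNReal.toReal_le_of_le_ofReal (by positivity) hb.1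

/-- A Gamma integral after the substitution `y ^ 2`; `k < 2 * l` is integrability at 0. -/
lemma integrable_rpow_nakagamiMeasure {l k : ℝ} (hl : 0 < l) (hk : k < 2 * l) :
    Integrable (fun y : ℝ => y ^ (-k)) (nakagamiMeasure l 1) ∧
    ∫ y, y ^ (-k) ∂(nakagamiMeasure l 1) = l ^ (k / 2) * Real.Gamma (l - k / 2) / Real.Gamma l := by
  have hΓ := Real.Gamma_pos_of_pos hl
  have hmeas : Measurable fun x => ENNReal.ofReal (nakagamiPDFReal l 1 x) :=
    (measurable_nakagamiPDFReal l).ennreal_ofReal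
  have hfin : ∀ᵐ x : ℝ, ENNReal.ofReal (nakagamiPDFReal l 1 x) < ∞ :=
    Eventually.of_forall fun _ => ENNReal.ofReal_lt_top
  have hrep : (fun y : ℝ => (ENNReal.ofReal (nakagamiPDFReal l 1 y)).toReal • y ^ (-k)) =ᵐ[volume]
      (Ioi 0).indicator fun y => 2 * l ^ l / Real.Gamma l *
        (y ^ (2 * l - 1 - k) * Real.exp (-l * y ^ (2 : ℝ))) := by
    have h0 : ∀ᵐ y : ℝ, y ≠ 0 := by simp [ae_iff]
    filter_upwards [h0] with y hy0
    rw [ENNReal.toReal_ofReal (nakagamiPDFReal_nonneg hl y), smul_eq_mul]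
    rcases lt_or_gt_of_ne hy0 with hy | hy
    · rw [indicator_of_notMem (by simpa using hy.le)]
      simp [nakagamiPDFReal, hy.not_ge]
    · rw [indicator_of_mem (by simpa using hy), nakagamiPDFReal_of_pos hy,
        sub_eq_add_neg (2 * l - 1) k, Real.rpow_add hy, Real.rpow_two]
      ring
  constructor
  · rw [nakagamiMeasure, integrable_withDensity_iff_integrable_smul' hmeas hfin,
      integrable_congr hrep, integrable_indicator_iff measurableSet_Ioi]
    exact (integrableOn_rpow_mul_exp_neg_mul_rpow (by linarith) (by norm_num) hl).const_mul _
  · rw [nakagamiMeasure, integral_withDensity_eq_integral_toReal_smul hmeas hfin,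
      integral_congr_ae hrep, integral_indicator measurableSet_Ioi, integral_const_mul,
      integral_rpow_mul_exp_neg_mul_rpow (by norm_num) (by linarith) hl]
    have e1 : (2 * l - 1 - k + 1) / 2 = l - k / 2 := by ring
    have e2 : -(2 * l - 1 - k + 1) / 2 = k / 2 - l := by ring
    rw [e1, e2, Real.rpow_sub hl]
    have := Real.rpow_pos_of_pos hl l
    field_simp

/-- Legendre duplication at `l - s` accounts for √π and the power of 4. The form `2 * s / 2` matches
the moment formula at `k = 2 * s`. -/
lemma mTilde_div_Gamma {s l : ℝ} (hs : 0 < s) (hsl : s < l) :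
    mTilde s l / Real.Gamma (2 * s + 1) =
      s ^ s / Real.Gamma (s + 1) * (l ^ (2 * s / 2) * Real.Gamma (l - 2 * s / 2) / Real.Gamma l) := by
  have hl : 0 < l := hs.trans hsl
  have hd := Real.Gamma_mul_Gamma_add_half (l - s)
  have h1 := Real.Gamma_pos_of_pos hs
  have h2 := Real.Gamma_pos_of_pos hl
  have h3 := Real.Gamma_pos_of_pos (show 0 < 2 * s by linarith)
  have h4 := Real.Gamma_pos_of_pos (show 0 < l - s + 1 / 2 by linarith)
  have e1 : (4 : ℝ) ^ (s - l + 1) = 4 * 4 ^ (s - l) := by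
    rw [Real.rpow_add_one (by norm_num), mul_comm]
  have e2 : (2 : ℝ) ^ (1 - 2 * (l - s)) = 2 * 4 ^ (s - l) := by
    rw [show (1 - 2 * (l - s)) = 1 + 2 * (s - l) by ring, Real.rpow_add (by norm_num),
      Real.rpow_mul (by norm_num), Real.rpow_one]
    norm_num
  have e3 : 2 * s / 2 = s := by ring
  rw [e2, show 2 * (l - s) = 2 * l - 2 * s by ring] at hd
  rw [mTilde, Real.Gamma_add_one hs.ne', Real.Gamma_add_one (by linarith : 2 * s ≠ 0),
    Real.mul_rpow hs.le hl.le, e1, e3]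
  have h5 := Real.rpow_pos_of_pos hs s
  have h6 := Real.rpow_pos_of_pos hl s
  generalize Real.Gamma (l - s + 1 / 2) = G at *
  generalize Real.Gamma (2 * l - 2 * s) = G' at *
  field_simp
  linear_combination -2 * hd

/-- Two Nakagami factors with distinct shapes: the smaller shape governs the product at `0`. -/
lemma hasPowerCDF_nakagamiMeasure_mconv {s l : ℝ} [IsFiniteMeasure (nakagamiMeasure s 1)]
    [IsFiniteMeasure (nakagamiMeasure l 1)] (hs : 0 < s) (hsl : s < l) :
    HasPowerCDF (nakagamiMeasure l 1 ∗ₘ nakagamiMeasure s 1) (2 * s)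
      (mTilde s l / Real.Gamma (2 * s + 1)) := by
  have hl : 0 < l := hs.trans hsl
  obtain ⟨hi, hv⟩ := integrable_rpow_nakagamiMeasure hl (show 2 * s < 2 * l by linarith)
  have hΓ' := Real.Gamma_pos_of_pos (show 0 < s + 1 by linarith)
  have h := (hasPowerCDF_nakagamiMeasure hs).mconv (C := s ^ s / Real.Gamma (s + 1))
    (nakagamiMeasure_Iic_zero l) (fun x hx => ENNReal.toReal_le_of_le_ofReal
      (by have := Real.rpow_nonneg (le_of_lt hx) (2 * s); positivity)
      (nakagamiMeasure_Iio_bounds hs hx).1) hi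
  rwa [hv, ← mTilde_div_Gamma hs hsl] at h

lemma mTilde_pos {s l : ℝ} (hs : 0 < s) (hsl : s < l) : 0 < mTilde s l := by
  have hl : 0 < l := hs.trans hsl
  have h1 := Real.Gamma_pos_of_pos hs
  have h2 := Real.Gamma_pos_of_pos hl
  have h3 := Real.Gamma_pos_of_pos (show 0 < 2 * s by linarith)
  have h4 := Real.Gamma_pos_of_pos (show 0 < l - s + 1 / 2 by linarith)
  have h5 := Real.Gamma_pos_of_pos (show 0 < 2 * l - 2 * s by linarith)
  have := Real.pi_pos
  unfold mTilde
  positivity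

/-- Sums of independent variables with a common power-law distribution function at `0`. -/
lemma hasPowerCDF_map_sum {Ω ι : Type*} [MeasurableSpace Ω] {μ : Measure Ω}
    [IsProbabilityMeasure μ] {Z : ι → Ω → ℝ} (hZ : ∀ i, Measurable (Z i))
    (hind : ∀ (s : Finset ι) (a : ι), a ∉ s → IndepFun (∑ i ∈ s, Z i) (Z a) μ)
    {k b : ℝ} (hk : 0 < k) (hb : 0 < b)
    (h : ∀ i, HasPowerCDF (μ.map (Z i)) k (b / Real.Gamma (k + 1)))
    {s : Finset ι} (hs : s.Nonempty) :
    HasPowerCDF (μ.map (∑ i ∈ s, Z i)) (k * s.card)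
      (b ^ s.card / Real.Gamma (k * s.card + 1)) := by
  classical
  induction hs using Finset.Nonempty.cons_induction with
  | singleton a => simpa using h a
  | cons a s ha hs ih =>
    have hcard : (0 : ℝ) < s.card := by exact_mod_cast hs.card_pos
    have hm : Measurable (∑ i ∈ s, Z i) := by
      simpa [Finset.sum_fn] using Finset.measurable_sum s fun i _ => hZ i
    have hi : IndepFun (∑ i ∈ s, Z i) (Z a) μ := hind s a ha
    have := Measure.isProbabilityMeasure_map (μ := μ) hm.aemeasurable
    have := Measure.isProbabilityMeasure_map (μ := μ) (hZ a).aemeasurable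
    have h1 := Real.Gamma_pos_of_pos (show 0 < k + 1 by linarith)
    have h2 := Real.Gamma_pos_of_pos (show 0 < k * s.card + 1 by positivity)
    have key := ih.conv (h a) (by positivity) hk (by positivity) (by positivity)
    rw [← hi.map_add_eq_map_conv_map hm (hZ a)] at key
    rw [Finset.sum_cons, Finset.card_cons, add_comm (Z a)]
    convert key using 1
    · push_cast; ring
    · push_cast
      -- The Gamma factors of the two summands cancel those in the Beta constant.
      rw [show k * ((s.card : ℝ) + 1) = k * s.card + k by ring, pow_succ]
      field_simp

/-! ### Bob's aligned gain and Willie's Gaussian channel. -/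

/-- Each phase cancels the argument of its path, leaving the common factor `exp (θ₀ * I)` of modulus
1. -/
lemma bobGain_eq {N : ℕ} {β : ℝ} (hβ : 0 ≤ β) (θ₀ : ℝ) (hRB hAR : Fin N → ℂ) :
    bobGain β θ₀ hRB hAR = β * ∑ n, ‖hAR n‖ * ‖hRB n‖ := by
  have h : hRB ⬝ᵥ (reflectionMatrix β (optimalPhase θ₀ hRB hAR) *ᵥ hAR) =
      Complex.exp (θ₀ * Complex.I) * ((β * ∑ n, ‖hAR n‖ * ‖hRB n‖ : ℝ) : ℂ) := by
    simp only [dotProduct, reflectionMatrix, Matrix.mulVec_diagonal, optimalPhase]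
    push_cast
    rw [Finset.mul_sum, Finset.mul_sum]
    refine Finset.sum_congr rfl fun n _ => ?_
    have hpol := Complex.norm_mul_exp_arg_mul_I (hRB n * hAR n)
    have hexp : Complex.exp (Complex.I * ((θ₀ : ℂ) - Complex.arg (hRB n * hAR n))) *
        Complex.exp (Complex.arg (hRB n * hAR n) * Complex.I) = Complex.exp (θ₀ * Complex.I) := by
      rw [← Complex.exp_add]; ring_nf
    calc _ = β * Complex.exp (Complex.I * ((θ₀ : ℂ) - Complex.arg (hRB n * hAR n))) *
          (hRB n * hAR n) := by ring
      _ = _ := by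
        rw [← hexp]
        nth_rewrite 2 [← hpol]
        rw [norm_mul]
        push_cast
        ring
  rw [bobGain, h, norm_mul, Complex.norm_exp_ofReal_mul_I, one_mul, Complex.norm_real,
    Real.norm_of_nonneg]
  exact mul_nonneg hβ (Finset.sum_nonneg fun n _ => by positivity)

lemma circularGaussian_singleton_zero {v : ℝ≥0} (hv : v ≠ 0) : circularGaussian v {0} = 0 := by
  have hv2 : v / 2 ≠ 0 := by positivity
  rw [circularGaussian, MeasurableEquiv.map_apply]
  refine measure_mono_null (t := {0} ×ˢ univ) ?_ ?_
  · intro x hx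
    have hx : Complex.measurableEquivRealProd.symm x = 0 := hx
    have := congrArg Complex.re hx
    simp only [mem_prod, mem_singleton_iff, mem_univ, and_true]
    simpa using this
  · have := nullSingletonClass_gaussianReal (μ := 0) hv2
    simp

/-- Continuity from above: the balls are closed thickenings of the null set `{0}`, for radii `r ≥
0`. -/
lemma tendsto_circularGaussian_closedBall {v : ℝ≥0} (hv : v ≠ 0) :
    Tendsto (fun r => (circularGaussian v).real (Metric.closedBall 0 r)) (𝓝[≥] 0) (𝓝 0) := by
  have : IsProbabilityMeasure (circularGaussian v) :=
    Measure.isProbabilityMeasure_map (by fun_prop)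
  have h := tendsto_measure_cthickening_of_isClosed (μ := circularGaussian v) (s := {0})
    ⟨1, one_pos, measure_ne_top _ _⟩ isClosed_singleton
  rw [circularGaussian_singleton_zero hv] at h
  have h' := (ENNReal.tendsto_toReal ENNReal.zero_ne_top).comp (h.mono_left (nhdsWithin_le_nhds (s := Ici 0)))
  refine h'.congr' ?_
  filter_upwards [self_mem_nhdsWithin] with r hr
  simp only [Function.comp, Metric.cthickening_singleton _ hr, measureReal_def]

/-! ### Deterministic rate comparisons. -/

variable (p : Params)

lemma Params.L1_pos : 0 < p.L1 :=
  mul_pos (Real.rpow_pos_of_pos p.dRB_pos _) (Real.rpow_pos_of_pos p.dAR_pos _)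

lemma Params.L2_pos : 0 < p.L2 :=
  mul_pos (Real.rpow_pos_of_pos p.dRW_pos _) (Real.rpow_pos_of_pos p.dAR_pos _)

lemma Params.one_lt_two_rpow : 1 < (2 : ℝ) ^ (p.R / p.B) :=
  Real.one_lt_rpow (by norm_num) (div_pos p.R_pos p.B_pos)

lemma Params.c1_pos : 0 < p.c1 := by
  have := p.L1_pos
  have := p.β_pos
  have := sub_pos.2 p.one_lt_two_rpow
  unfold Params.c1
  positivity

lemma rate_lt_iff {y : ℝ} (hy : 0 ≤ y) : rate p y < p.R ↔ 1 + y < 2 ^ (p.R / p.B) := by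
  rw [rate, ← Real.logb_lt_iff_lt_rpow (by norm_num) (by linarith), lt_div_iff₀' p.B_pos]

/-- Secrecy mode, once selected, meets the target by the choice of the switching threshold. -/
lemma jsaccRate_lt_iff (Pt G : ℝ) (g : ℂ) : jsaccRate p Pt G g < p.R ↔
    secrecyRate p Pt G g < p.R ∧ rate p (sinrBobCC p Pt G) < p.R := by
  unfold jsaccRate
  split_ifs with h
  · exact ⟨fun h' => absurd h h'.not_ge, fun h' => h'.1⟩
  · exact ⟨fun h' => ⟨not_le.1 h, h'⟩, fun h' => h'.2⟩

lemma secrecyRate_lt {Pt G : ℝ} {g : ℂ} (hPt : 0 ≤ Pt) (hW : 1 / p.κ ≤ sinrWillieSC p Pt g)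
    (hCC : rate p (sinrBobCC p Pt G) < p.R) : secrecyRate p Pt G g < p.R := by
  have hκ := p.κ_pos
  have hL1 := p.L1_pos
  have hT := p.one_lt_two_rpow
  have hB : 0 ≤ sinrBobSC p Pt G := by unfold sinrBobSC; positivity
  have e : sinrBobCC p Pt G = p.κ * sinrBobSC p Pt G := by
    unfold sinrBobCC sinrBobSC; ring
  rw [e, rate_lt_iff p (by positivity)] at hCC
  set y := sinrBobSC p Pt G
  set w := sinrWillieSC p Pt g
  set T := (2 : ℝ) ^ (p.R / p.B) with hTdef
  have hw : 0 < w := (by positivity : 0 < 1 / p.κ).trans_le hW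
  have hκw : 1 ≤ p.κ * w := by rwa [div_le_iff₀' hκ] at hW
  have hlt : 1 + y < T * (1 + w) := by
    -- Covert failure gives κ(1 + y) < T - 1 + κ ≤ T, while κw ≥ 1 gives T ≤ κTw < κT(1 + w).
    have : p.κ * (1 + y) < p.κ * (T * (1 + w)) := by nlinarith [p.κ_le_one]
    exact lt_of_mul_lt_mul_left this hκ.le
  refine max_lt ?_ p.R_pos
  have h1 : Real.logb 2 (1 + y) < p.R / p.B + Real.logb 2 (1 + w) := by
    have h2 := Real.logb_lt_logb (b := 2) (by norm_num) (by linarith) hlt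
    rwa [Real.logb_mul (by positivity) (by positivity), hTdef,
      Real.logb_rpow (by norm_num) (by norm_num)] at h2
  have h3 := mul_lt_mul_of_pos_left h1 p.B_pos
  rw [mul_add, mul_div_cancel₀ _ p.B_pos.ne'] at h3
  unfold rate
  linarith

lemma rate_sinrBobCC_lt_iff {ρ S : ℝ} (hρ : 0 < ρ) (hS : 0 ≤ S) :
    rate p (sinrBobCC p (ρ * p.σB ^ 2) (p.β * S)) < p.R ↔ S < p.c1 / Real.sqrt (p.κ * ρ) := by
  have hκ := p.κ_pos
  have hL1 := p.L1_pos
  have hβ := p.β_pos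
  have hσ := p.σB_pos
  have e : sinrBobCC p (ρ * p.σB ^ 2) (p.β * S) = S ^ 2 * (p.β ^ 2 * p.L1 * (p.κ * ρ)) := by
    unfold sinrBobCC; field_simp
  rw [e, rate_lt_iff p (by positivity), Params.c1, ← Real.sqrt_div' _ (by positivity),
    Real.lt_sqrt hS, div_div, lt_div_iff₀ (by positivity), lt_sub_iff_add_lt']

lemma one_div_κ_le_sinrWillieSC {ρ : ℝ} (hρ : 0 < ρ) {g : ℂ}
    (hg : Real.sqrt (p.σW ^ 2 / (p.κ * p.σB ^ 2 * p.β ^ 2 * p.L2) / ρ) < ‖g‖) :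
    1 / p.κ ≤ sinrWillieSC p (ρ * p.σB ^ 2) g := by
  have hκ := p.κ_pos
  have hL2 := p.L2_pos
  have hβ := p.β_pos
  have hσ := p.σB_pos
  have hσW := p.σW_pos
  rw [Real.sqrt_lt' ((Real.sqrt_nonneg _).trans_lt hg), div_div, div_lt_iff₀ (by positivity)] at hg
  unfold sinrWillieSC
  rw [div_le_div_iff₀ hκ (by positivity)]
  linarith

/-! ### Independence and reduction to the law of the sum. -/

/-- The two sides depend on disjoint blocks of the jointly independent family, indexed by `s ⊕ s`
and `{a} ⊕ {a}`. -/
lemma indepFun_sum_norm_mul_norm {Ω ι : Type*} [MeasurableSpace Ω] {μ : Measure Ω}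
    {X Y : ι → Ω → ℂ} (hX : ∀ n, Measurable (X n)) (hY : ∀ n, Measurable (Y n))
    (h : iIndepFun (fun i : ι ⊕ ι => Sum.elim X Y i) μ) {s : Finset ι} {a : ι} (ha : a ∉ s) :
    IndepFun (∑ i ∈ s, fun ω => ‖X i ω‖ * ‖Y i ω‖) (fun ω => ‖X a ω‖ * ‖Y a ω‖) μ := by
  classical
  have hd : Disjoint (s.disjSum s) (({a} : Finset ι).disjSum {a}) := by
    rw [Finset.disjoint_left]
    rintro (i | i) hi hi' <;> simp at hi hi' <;> exact ha (hi' ▸ hi)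
  have hm : ∀ i : ι ⊕ ι, Measurable (Sum.elim X Y i) := by
    rintro (i | i)
    · exact hX i
    · exact hY i
  have key := h.indepFun_finset _ _ hd hm
  let φ : ({i // i ∈ s.disjSum s} → ℂ) → ℝ := fun v =>
    ∑ i : s, ‖v ⟨Sum.inl i, Finset.inl_mem_disjSum.2 i.2⟩‖ *
      ‖v ⟨Sum.inr i, Finset.inr_mem_disjSum.2 i.2⟩‖
  let ψ : ({i // i ∈ ({a} : Finset ι).disjSum ({a} : Finset ι)} → ℂ) → ℝ := fun v =>
    ‖v ⟨Sum.inl a, Finset.inl_mem_disjSum.2 (Finset.mem_singleton_self a)⟩‖ *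
      ‖v ⟨Sum.inr a, Finset.inr_mem_disjSum.2 (Finset.mem_singleton_self a)⟩‖
  have hφ : Measurable φ := by fun_prop
  have hψ : Measurable ψ := by fun_prop
  convert key.comp hφ hψ using 1
  · ext ω
    simp only [Finset.sum_apply, Function.comp, φ, Sum.elim_inl, Sum.elim_inr]
    exact (Finset.sum_coe_sort s fun i => ‖X i ω‖ * ‖Y i ω‖).symm
  · rfl

/-- The distribution function at `0` of a product of two independent Nakagami variables. -/
lemma hasPowerCDF_map_mul {Ω : Type*} [MeasurableSpace Ω] {μ : Measure Ω}
    [IsProbabilityMeasure μ] {X Y : Ω → ℝ} {a b : ℝ} (ha : 0 < a) (hb : 0 < b) (hab : a ≠ b)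
    (hX : HasLaw X (nakagamiMeasure a 1) μ) (hY : HasLaw Y (nakagamiMeasure b 1) μ)
    (hind : IndepFun X Y μ) :
    HasPowerCDF (μ.map fun ω => X ω * Y ω) (2 * min b a)
      (mTilde (min b a) (max b a) / Real.Gamma (2 * min b a + 1)) := by
  have hXm := hX.aemeasurable
  have hYm := hY.aemeasurable
  -- Total mass 1 is inherited from the law of `X`, with no integration of the density.
  have : IsProbabilityMeasure (nakagamiMeasure a 1) :=
    hX.map_eq ▸ Measure.isProbabilityMeasure_map hXm
  have : IsProbabilityMeasure (nakagamiMeasure b 1) :=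
    hY.map_eq ▸ Measure.isProbabilityMeasure_map hYm
  have h := hind.map_mul_eq_map_mconv_map₀ hXm hYm
  rw [hX.map_eq, hY.map_eq] at h
  change HasPowerCDF (μ.map (X * Y)) _ _
  rw [h]
  rcases lt_or_gt_of_ne hab with hlt | hlt
  · rw [min_eq_right hlt.le, max_eq_left hlt.le, Measure.mconv_comm]
    exact hasPowerCDF_nakagamiMeasure_mconv ha hlt
  · rw [min_eq_left hlt.le, max_eq_right hlt.le]
    exact hasPowerCDF_nakagamiMeasure_mconv hb hlt

lemma outageInfty_eq (p : Params) (N : ℕ) (s l : ℝ) {ρ : ℝ} (hρ : 0 < ρ) :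
    outageInfty p N s l ρ = mTilde s l ^ N / Real.Gamma (2 * s * N + 1) *
      (p.c1 / Real.sqrt (p.κ * ρ)) ^ (2 * s * N) := by
  have hκ := p.κ_pos
  have hc := p.c1_pos
  rw [outageInfty, Real.div_rpow hc.le (Real.sqrt_nonneg _), Real.sqrt_eq_rpow,
    ← Real.rpow_mul (by positivity), show 1 / 2 * (2 * s * N) = s * N by ring,
    Real.mul_rpow hκ.le hρ.le, Real.rpow_neg hκ.le, Real.rpow_neg hρ.le]
  field_simp

/-- Outage of the joint scheme forces covert outage, and covert outage together with a Willie
channel that is not too weak forces outage of the joint scheme. -/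
lemma outageProb_bounds {Ω : Type*} [MeasurableSpace Ω] {μ : Measure Ω} [IsProbabilityMeasure μ]
    {N : ℕ} (p : Params) (θ₀ : ℝ) {hAR hRB : Fin N → Ω → ℂ} {gARW : Ω → ℂ} {ν : Measure ℂ}
    (hg : HasLaw gARW ν μ)
    (hind : IndepFun gARW (fun ω => (fun n => hAR n ω, fun n => hRB n ω)) μ)
    {ρ : ℝ} (hρ : 0 < ρ) :
    (1 - ν.real (Metric.closedBall 0
        (Real.sqrt (p.σW ^ 2 / (p.κ * p.σB ^ 2 * p.β ^ 2 * p.L2) / ρ)))) *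
      μ.real {ω | ∑ n, ‖hAR n ω‖ * ‖hRB n ω‖ < p.c1 / Real.sqrt (p.κ * ρ)} ≤
        outageProb μ p θ₀ hAR hRB gARW ρ ∧
    outageProb μ p θ₀ hAR hRB gARW ρ ≤
      μ.real {ω | ∑ n, ‖hAR n ω‖ * ‖hRB n ω‖ < p.c1 / Real.sqrt (p.κ * ρ)} := by
  have hS : ∀ ω, 0 ≤ ∑ n, ‖hAR n ω‖ * ‖hRB n ω‖ := fun ω =>
    Finset.sum_nonneg fun n _ => by positivity
  have hGain : ∀ ω, bobGain p.β θ₀ (fun n => hRB n ω) (fun n => hAR n ω) =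
      p.β * ∑ n, ‖hAR n ω‖ * ‖hRB n ω‖ := fun ω => bobGain_eq p.β_pos.le _ _ _
  have hσ := p.σB_pos
  set r := Real.sqrt (p.σW ^ 2 / (p.κ * p.σB ^ 2 * p.β ^ 2 * p.L2) / ρ) with hr
  set x := p.c1 / Real.sqrt (p.κ * ρ)
  have : IsProbabilityMeasure ν := hg.map_eq ▸ Measure.isProbabilityMeasure_map hg.aemeasurable
  constructor
  · let f : (Fin N → ℂ) × (Fin N → ℂ) → ℝ := fun v => ∑ n, ‖v.1 n‖ * ‖v.2 n‖
    have hf : Measurable f := by fun_prop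
    -- Independence factors the event that `gARW` leaves the ball and covert mode fails, which lies
    -- inside the outage event.
    have hset := hind.measure_inter_preimage_eq_mul (Metric.closedBall 0 r)ᶜ (f ⁻¹' Iio x)
      Metric.isClosed_closedBall.measurableSet.compl (hf measurableSet_Iio)
    have hgν : μ (gARW ⁻¹' (Metric.closedBall 0 r)ᶜ) = ν (Metric.closedBall 0 r)ᶜ := by
      rw [← hg.map_eq, Measure.map_apply_of_aemeasurable hg.aemeasurable
        Metric.isClosed_closedBall.measurableSet.compl]
    rw [← probReal_compl_eq_one_sub Metric.isClosed_closedBall.measurableSet]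
    have e : ν.real (Metric.closedBall 0 r)ᶜ * μ.real {ω | ∑ n, ‖hAR n ω‖ * ‖hRB n ω‖ < x} =
        μ.real (gARW ⁻¹' (Metric.closedBall 0 r)ᶜ ∩
          (fun ω => (fun n => hAR n ω, fun n => hRB n ω)) ⁻¹' (f ⁻¹' Iio x)) := by
      rw [measureReal_def, measureReal_def, measureReal_def, hset, hgν, ENNReal.toReal_mul]
      rfl
    rw [e]
    refine measureReal_mono fun ω hω => ?_
    have h1 : r < ‖gARW ω‖ := by simpa using hω.1
    have h2 : ∑ n, ‖hAR n ω‖ * ‖hRB n ω‖ < x := hω.2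
    have hCC := (rate_sinrBobCC_lt_iff p hρ (hS ω)).2 h2
    rw [mem_ofPred_eq, jsaccRate_lt_iff, hGain]
    exact ⟨secrecyRate_lt p (by positivity) (one_div_κ_le_sinrWillieSC p hρ h1) hCC, hCC⟩
  · refine measureReal_mono fun ω hω => ?_
    rw [mem_ofPred_eq, jsaccRate_lt_iff, hGain] at hω
    exact (rate_sinrBobCC_lt_iff p hρ (hS ω)).1 hω.2

end JSACC

/-! ### Assembly of the asymptotic equivalence. -/

theorem mainTheorem2 {Ω : Type*} [MeasurableSpace Ω] (μ : Measure Ω) [IsProbabilityMeasure μ]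
    (N : ℕ) (hN : 1 ≤ N) (p : JSACC.Params) (θ₀ : ℝ)
    (mAR mRB : ℝ) (hmAR : 0 < mAR) (hmRB : 0 < mRB) (hne : mAR ≠ mRB)
    (hAR hRB : Fin N → Ω → ℂ) (gARW : Ω → ℂ)
    (hAR_meas : ∀ n, Measurable (hAR n)) (hRB_meas : ∀ n, Measurable (hRB n))
    (hAR_law : ∀ n, HasLaw (fun ω => ‖hAR n ω‖) (JSACC.nakagamiMeasure mAR 1) μ)
    (hRB_law : ∀ n, HasLaw (fun ω => ‖hRB n ω‖) (JSACC.nakagamiMeasure mRB 1) μ)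
    (h_indep : iIndepFun (fun i : Fin N ⊕ Fin N => Sum.elim hAR hRB i) μ)
    (gARW_law : HasLaw gARW (JSACC.circularGaussian (N : ℝ≥0)) μ)
    (gARW_indep : IndepFun gARW (fun ω => (fun n => hAR n ω, fun n => hRB n ω)) μ) :
    JSACC.outageProb μ p θ₀ hAR hRB gARW ~[atTop]
      JSACC.outageInfty p N (min mRB mAR) (max mRB mAR) := by
  open JSACC Set Topology in
  have hs : 0 < min mRB mAR := lt_min hmRB hmAR
  have hsl : min mRB mAR < max mRB mAR := min_lt_max.2 hne.symm
  have hm := mTilde_pos hs hsl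
  have hN0 : (0 : ℝ) < N := by exact_mod_cast hN
  have hZm : ∀ n, Measurable fun ω => ‖hAR n ω‖ * ‖hRB n ω‖ := fun n =>
    (hAR_meas n).norm.mul (hRB_meas n).norm
  have hprod : ∀ n, HasPowerCDF (μ.map fun ω => ‖hAR n ω‖ * ‖hRB n ω‖) (2 * min mRB mAR)
      (mTilde (min mRB mAR) (max mRB mAR) / Real.Gamma (2 * min mRB mAR + 1)) := fun n =>
    hasPowerCDF_map_mul hmAR hmRB hne (hAR_law n) (hRB_law n)
      ((h_indep.indepFun (Sum.inl_ne_inr (a := n) (b := n))).comp measurable_norm measurable_norm)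
  -- The induction for sums starts at one summand, hence the need for `1 ≤ N`.
  have : Nonempty (Fin N) := ⟨⟨0, hN⟩⟩
  have hsum := (hasPowerCDF_map_sum hZm
    (fun s a ha => indepFun_sum_norm_mul_norm hAR_meas hRB_meas h_indep ha)
    (by positivity) hm hprod Finset.univ_nonempty).tendsto
  rw [Finset.card_univ, Fintype.card_fin] at hsum
  generalize min mRB mAR = s at *
  generalize max mRB mAR = l at *
  set A := mTilde s l ^ N / Real.Gamma (2 * s * N + 1) with hA
  have hApos : 0 < A := by
    have := Real.Gamma_pos_of_pos (show 0 < 2 * s * N + 1 by positivity)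
    positivity
  have hκ := p.κ_pos
  have hc := p.c1_pos
  have hx : Tendsto (fun ρ => p.c1 / Real.sqrt (p.κ * ρ)) atTop (𝓝[>] 0) := by
    refine tendsto_nhdsWithin_iff.2 ⟨?_, ?_⟩
    · exact tendsto_const_nhds.div_atTop
        (Real.tendsto_sqrt_atTop.comp (tendsto_id.const_mul_atTop hκ))
    · filter_upwards [eventually_gt_atTop 0] with ρ hρ
      exact div_pos hc (Real.sqrt_pos.2 (by positivity))
  have hr : Tendsto (fun ρ =>
      Real.sqrt (p.σW ^ 2 / (p.κ * p.σB ^ 2 * p.β ^ 2 * p.L2) / ρ)) atTop (𝓝[≥] 0) := by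
    refine tendsto_nhdsWithin_iff.2 ⟨?_, Eventually.of_forall fun ρ => Real.sqrt_nonneg _⟩
    have := (tendsto_const_nhds (x := p.σW ^ 2 / (p.κ * p.σB ^ 2 * p.β ^ 2 * p.L2))).div_atTop
      (tendsto_id (α := ℝ))
    simpa [Function.comp_def] using (Real.continuous_sqrt.tendsto _).comp this
  have hball := (tendsto_circularGaussian_closedBall
    (Nat.cast_ne_zero.2 (by omega) : (N : ℝ≥0) ≠ 0)).comp hr
  have hF : Tendsto (fun ρ => μ.real {ω | ∑ n, ‖hAR n ω‖ * ‖hRB n ω‖ < p.c1 / √(p.κ * ρ)} /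
      (p.c1 / √(p.κ * ρ)) ^ (2 * s * N)) atTop (𝓝 A) := by
    refine (hsum.comp hx).congr fun ρ => ?_
    have hmeas : Measurable (∑ n, fun ω => ‖hAR n ω‖ * ‖hRB n ω‖) := by
      simpa [Finset.sum_fn] using Finset.measurable_sum Finset.univ fun i _ => hZm i
    simp only [Function.comp]
    rw [map_measureReal_apply hmeas measurableSet_Iio]
    congr 2
    ext ω
    simp
  have hlim : Tendsto (fun ρ => outageProb μ p θ₀ hAR hRB gARW ρ /
      (p.c1 / √(p.κ * ρ)) ^ (2 * s * N)) atTop (𝓝 A) := by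
    have hlow := (hball.const_sub 1).mul hF
    rw [sub_zero, one_mul] at hlow
    -- Squeeze: the lower bound's extra factor tends to 1 since the ball's mass tends to 0.
    refine tendsto_of_tendsto_of_tendsto_of_le_of_le' hlow hF ?_ ?_ <;>
      filter_upwards [eventually_gt_atTop 0] with ρ hρ <;>
      have hb := outageProb_bounds p θ₀ gARW_law gARW_indep hρ <;>
      have hxk : 0 < (p.c1 / √(p.κ * ρ)) ^ (2 * s * N) := by positivity
    · rw [← mul_div_assoc]
      exact div_le_div_of_nonneg_right hb.1 hxk.le
    · exact div_le_div_of_nonneg_right hb.2 hxk.le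
  have hne0 : ∀ᶠ ρ in atTop, outageInfty p N s l ρ ≠ 0 := by
    filter_upwards [eventually_gt_atTop 0] with ρ hρ
    rw [outageInfty_eq p N s l hρ]
    positivity
  rw [isEquivalent_iff_tendsto_one hne0]
  have hfin := hlim.div_const A
  rw [div_self hApos.ne'] at hfin
  refine hfin.congr' ?_
  filter_upwards [eventually_gt_atTop 0] with ρ hρ
  rw [Pi.div_apply, outageInfty_eq p N s l hρ, ← hA, div_div, mul_comm A]
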